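/- **Theorem.** Let $\mathbb{Z}((q,z))=\mathbb{Z}[[q,z]][q^{-1},z^{-1}]$ and let $A=\mathbb{Z}((q,z))[\,S(\rho|\sigma):\rho,\sigma\in\mathbb{Z}^3\,]$ be the polynomial ring in the formal variables $S(\rho|\sigma)=S_{13}(\rho|\sigma)$. Let $\delta_1,\delta_2,\delta_3$ be the unit vectors of $\mathbb{Z}^3$ and put $\epsilon_i=\delta_1+\dots+\delta_i$. For $\rho,\sigma\in\mathbb{Z}^3$ and $i\in\{1,2\}$ let $$\begin{aligned} R_1^{(i)}(\rho|\sigma)&=S(\rho|\sigma)-S(\rho+\delta_i-\delta_{i+1}|\sigma)-zq^{\,i+\rho_1+\dots+\rho_i}S(\rho+2\epsilon_i|\sigma-\epsilon_i),\\ R_2^{(i)}(\rho|\sigma)&=S(\rho|\sigma)-S(\rho|\sigma+\delta_i-\delta_{i+1})-q^{\,i+\sigma_1+\dots+\sigma_i}S(\rho-\epsilon_i|\sigma+2\epsilon_i),\\ R_3(\rho|\sigma)&=S(\rho|\sigma)-S(\rho|\sigma+\delta_3)-qS(\rho+\delta_3|\sigma+\delta_3)+qS(\rho+\delta_3|\sigma+2\delta_3)-q^{\,3+\sigma_1+\sigma_2+\sigma_3}S(\rho-\epsilon_3|\sigma+2\epsilon_3),\\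 R_4(\rho|\sigma)&=S(\rho|\sigma)-S(\rho+\delta_3|\sigma)-qS(\rho+\delta_3|\sigma+\delta_3)+qS(\rho+2\delta_3|\sigma+\delta_3)-zq^{\,3+\rho_1+\rho_2+\rho_3}S(\rho+2\epsilon_3|\sigma-\epsilon_3), \end{aligned}$$ and let $I_{13,6}\subset A$ be the ideal generated by all $R_1^{(i)}(\rho|\sigma),R_2^{(i)}(\rho|\sigma),R_3(\rho|\sigma),R_4(\rho|\sigma)$ with $i\in\{1,2\}$ and $\rho,\sigma\in\{-6,\dots,6\}^3$. To every triple $c=(c_1,c_2,c_3)$ of non-negative integers with $c_1+c_2+c_3=10$ associate the following expression $H_c(z)\in A$. It depends on $c$ only up to cyclic rotation, so assume $c_1\ge c_2$ and $c_1>c_3$. With $e_0=(1,1,1)$, $e_1=(0,1,1)$, $e_2=(0,0,1)$, $e_3=(0,0,0)$, if $c_2,c_3\le 3$ let $$H_c(z)=\begin{cases}S(e_{c_2}|e_{c_3})-qS(e_{c_2-1}|e_{c_3-1}),&c_2,c_3>0,\\ S(e_{c_2}|e_0),&c_3=0,\\ S(e_0|e_{c_3})-q(1-z)S((2,1,1)|e_{c_3-1}),&c_2=0,\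 c_3\ne0,\end{cases}$$ and for the six remaining profiles, writing $S(a_1a_2a_3|b_1b_2b_3)$ for $S((a_1,a_2,a_3)|(b_1,b_2,b_3))$ and $\bar a=-a$, let $$\begin{aligned} H_{(6,4,0)}(z)={}&S(\bar100|111)-S(001|011)+qS(011|111)+(1-z)S(100|011)-q(1-z)S(101|111),\\ H_{(5,5,0)}(z)={}&S(\bar200|111)-S(\bar101|011)+qS(\bar111|111)+(1-\tfrac zq-z)S(000|011)-(q-z-qz)S(001|111)\\&-q(1-z)zS(100|111)-(1-z)S(101|001)+q(1-z)S(111|011)\\&+(1-z)(1-qz)S(200|001)-q(1-z)(1-qz)S(201|011),\\ H_{(5,4,1)}(z)={}&S(\bar100|011)-qS(\bar101|111)-zS(000|111)-S(001|001)+qS(011|011)\\&+(1-z)S(100|001)-q(1-z)S(101|011),\\ H_{(4,4,2)}(z)={}&S(\bar100|001)-qS(\bar101|011)-zS(000|011)-S(001|000)+qzS(001|111)+qS(011|001)\\&+(1-z)S(100|000)-qz(1-z)S(100|111)-q(1-z)S(101|001),\\ H_{(5,1,4)}(z)={}&S(\bar101|000)-qS(\bar111|001)-S(000|000)+(1-z)S(000|001)-(1-q)S(001|001)\\&-q(1-z)S(001|011)+qS(011|011)+(1-z)S(100|001)-q(1-z)zS(100|011)\\&-(1-z)S(101|000)-q(1-z)S(101|011)+q^2(1-z)zS(101|111)+(1-z)S(111|000)\\&+q(1-z)S(111|001)+(1-z)(1-qz)S(200|000)-q^2z(1-z)(1-qz)S(200|111)\\&-(1-z)(1-qz)S(201|000)-q(1-z)(1-qz)S(201|001)-q^2z(1-z)S(211|001),\\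 H_{(6,0,4)}(z)={}&S(001|000)-qS(011|001)-S(100|000)+(1-qz)S(100|001)-(1-q)S(101|001)\\&-q(1-qz)S(101|011)+qS(111|011)+(1-qz)S(200|001)-q^2z(1-qz)S(200|011)\\&-(1-qz)S(201|000)-q(1-qz)S(201|011)+q^3z(1-qz)S(201|111)+S(211|000)\\&+q(1-qz)S(211|001)+(1-qz)(1-q^2z)S(300|000)-q^3z(1-qz)(1-q^2z)S(300|111)\\&-(1-qz)(1-q^2z)S(301|000)-q(1-qz)(1-q^2z)S(301|001)-q^3z(1-qz)S(311|001). \end{aligned}$$ For $n\ge0$ let $H_c(zq^n)$ be obtained from $H_c(z)$ by replacing $z$ by $zq^n$ in all coefficients and each $S(\rho|\sigma)$ by $S(\rho+n\delta_1|\sigma)$. Let $I_c=\{i:c_i\neq0\}$ and, for $\emptyset\ne J\subseteq I_c$ and indices taken cyclically modulo $3$, let $c(J)$ have parts $c_i(J)=c_i-1$ if $i\in J,\ i-1\notin J$; $c_i(J)=c_i+1$ if $i\notin J,\ i-1\in J$; and $c_i(J)=c_i$ otherwise. Write $(zq;q)_L=\prod_{j=1}^{L}(1-zq^j)$. Then for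 every such $c$ (with $c_1+c_2+c_3=10$) the coupled relation lies in $I_{13,6}$: $$H_c(z)-\sum_{\emptyset\ne J\subseteq I_c}(-1)^{|J|-1}(zq;q)_{|J|-1}\,H_{c(J)}(zq^{|J|})\ \in\ I_{13,6}.$$ -/

import Mathlib

noncomputable section

namespace CylMod13

/-! ### The coefficient ring and the polynomial ring -/

/-- The coefficient ring `ℤ((q, z)) = ℤ[[q, z]][q⁻¹, z⁻¹]` of formal Laurent series in two
variables: the power series ring `ℤ[[q, z]]` with `q * z` inverted. -/
abbrev Coeff : Type :=
  Localization.Away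
    (MvPowerSeries.X 0 * MvPowerSeries.X 1 : MvPowerSeries (Fin 2) ℤ)

/-- The variable `q`. -/
def q : Coeff := algebraMap (MvPowerSeries (Fin 2) ℤ) Coeff (MvPowerSeries.X 0)

/-- The variable `z`. -/
def z : Coeff := algebraMap (MvPowerSeries (Fin 2) ℤ) Coeff (MvPowerSeries.X 1)

theorem isUnit_q : IsUnit q := by
  have h : IsUnit (algebraMap (MvPowerSeries (Fin 2) ℤ) Coeff
      (MvPowerSeries.X 0 * MvPowerSeries.X 1)) :=
    IsLocalization.Away.algebraMap_isUnit _
  rw [map_mul] at h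
  exact isUnit_of_mul_isUnit_left h

/-- `q ^ n` for an integer exponent `n`. -/
def qpow (n : ℤ) : Coeff := ((isUnit_q.unit ^ n : Coeffˣ) : Coeff)

/-- Integer vectors with `k - 1 = 3` entries. The entries `1, 2, 3` of the mathematical
notation are the entries `0, 1, 2` here. -/
abbrev Vec : Type := Fin 3 → ℤ

/-- The polynomial ring over `ℤ((q, z))` in the countably many formal variables
`S₁₃(ρ | σ)`, `ρ, σ ∈ ℤ³`. -/
abbrev Poly : Type := MvPolynomial (Vec × Vec) Coeff

/-- The formal variable `S₁₃(ρ | σ)`. -/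
def S (ρ σ : Vec) : Poly := MvPolynomial.X (ρ, σ)

/-! ### The relations and the ideal `I_{13,N}` -/

/-- The unit vector `δ_{j+1}`. -/
def delta (j : Fin 3) : Vec := Pi.single j 1

/-- `δ₁ + ⋯ + δ_i`, with `i` leading ones. -/
def prefixVec (i : ℕ) : Vec := fun j => if (j : ℕ) < i then 1 else 0

/-- `ρ₁ + ⋯ + ρ_i`. -/
def prefixSum (i : ℕ) (ρ : Vec) : ℤ := ∑ j : Fin 3, if (j : ℕ) < i then ρ j else 0

/-- `R₁^{(i+1)}(ρ | σ)` for `i = 0, 1`. -/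
def R1 (i : Fin 2) (ρ σ : Vec) : Poly :=
  S ρ σ - S (ρ + delta i.castSucc - delta i.succ) σ
    - (z * qpow (((i : ℕ) + 1 : ℕ) + prefixSum ((i : ℕ) + 1) ρ)) •
      S (ρ + 2 • prefixVec ((i : ℕ) + 1)) (σ - prefixVec ((i : ℕ) + 1))

/-- `R₂^{(i+1)}(ρ | σ)` for `i = 0, 1`. -/
def R2 (i : Fin 2) (ρ σ : Vec) : Poly :=
  S ρ σ - S ρ (σ + delta i.castSucc - delta i.succ)
    - qpow (((i : ℕ) + 1 : ℕ) + prefixSum ((i : ℕ) + 1) σ) •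
      S (ρ - prefixVec ((i : ℕ) + 1)) (σ + 2 • prefixVec ((i : ℕ) + 1))

/-- `R₃(ρ | σ)` for modulus `13`. -/
def R3 (ρ σ : Vec) : Poly :=
  S ρ σ - S ρ (σ + delta 2) - q • S (ρ + delta 2) (σ + delta 2)
    + q • S (ρ + delta 2) (σ + 2 • delta 2)
    - qpow (3 + prefixSum 3 σ) • S (ρ - prefixVec 3) (σ + 2 • prefixVec 3)

/-- `R₄(ρ | σ)` for modulus `13`. -/
def R4 (ρ σ : Vec) : Poly :=
  S ρ σ - S (ρ + delta 2) σ - q • S (ρ + delta 2) (σ + delta 2)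
    + q • S (ρ + 2 • delta 2) (σ + delta 2)
    - (z * qpow (3 + prefixSum 3 ρ)) • S (ρ + 2 • prefixVec 3) (σ - prefixVec 3)

/-- `I_{13,N}`: the ideal generated by all relations `R₁^{(i)}, R₂^{(i)}, R₃, R₄` at `(ρ | σ)`
with all entries of `ρ` and `σ` in `{-N, …, N}`. -/
def relIdeal (N : ℕ) : Ideal Poly :=
  Ideal.span {f | ∃ ρ σ : Vec,
    (∀ j, ρ j ∈ Set.Icc (-(N : ℤ)) N) ∧ (∀ j, σ j ∈ Set.Icc (-(N : ℤ)) N) ∧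
    ((∃ i, f = R1 i ρ σ) ∨ (∃ i, f = R2 i ρ σ) ∨ f = R3 ρ σ ∨ f = R4 ρ σ)}

/-! ### The claimed expressions for the functions `H_c` -/

/-- `e_i = (0, …, 0, 1, …, 1)` with `i` leading zeros. -/
def e (i : ℕ) : Vec := fun j => if (j : ℕ) < i then 0 else 1

/-- The general formula for `H_{(c₁, a, b)}` with `a, b ≤ 3`. Here and in `underLine`, `w` is the
argument substituted for `z`, and `T ρ σ` stands for `S₁₃(w; ρ | σ)`. -/
def overLine (w : Coeff) (T : Vec → Vec → Poly) (a b : ℕ) : Poly :=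
  if b = 0 then T (e a) (e 0)
  else if a = 0 then T (e 0) (e b) - (q * (1 - w)) • T ![2, 1, 1] (e (b - 1))
  else T (e a) (e b) - q • T (e (a - 1)) (e (b - 1))

/-- The explicit formulas for the six remaining profiles. -/
def underLine (w : Coeff) (T : Vec → Vec → Poly) : ℕ → ℕ → ℕ → Poly
  | 6, 4, 0 =>
      T ![-1, 0, 0] ![1, 1, 1] - T ![0, 0, 1] ![0, 1, 1] + q • T ![0, 1, 1] ![1, 1, 1]
      + (1 - w) • T ![1, 0, 0] ![0, 1, 1] - (q * (1 - w)) • T ![1, 0, 1] ![1, 1, 1]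
  | 5, 5, 0 =>
      T ![-2, 0, 0] ![1, 1, 1] - T ![-1, 0, 1] ![0, 1, 1] + q • T ![-1, 1, 1] ![1, 1, 1]
      + (1 - w * qpow (-1) - w) • T ![0, 0, 0] ![0, 1, 1]
      - (q - w - q * w) • T ![0, 0, 1] ![1, 1, 1]
      - (q * (1 - w) * w) • T ![1, 0, 0] ![1, 1, 1]
      - (1 - w) • T ![1, 0, 1] ![0, 0, 1]
      + (q * (1 - w)) • T ![1, 1, 1] ![0, 1, 1]
      + ((1 - w) * (1 - q * w)) • T ![2, 0, 0] ![0, 0, 1]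
      - (q * (1 - w) * (1 - q * w)) • T ![2, 0, 1] ![0, 1, 1]
  | 5, 4, 1 =>
      T ![-1, 0, 0] ![0, 1, 1] - q • T ![-1, 0, 1] ![1, 1, 1] - w • T ![0, 0, 0] ![1, 1, 1]
      - T ![0, 0, 1] ![0, 0, 1] + q • T ![0, 1, 1] ![0, 1, 1]
      + (1 - w) • T ![1, 0, 0] ![0, 0, 1] - (q * (1 - w)) • T ![1, 0, 1] ![0, 1, 1]
  | 4, 4, 2 =>
      T ![-1, 0, 0] ![0, 0, 1] - q • T ![-1, 0, 1] ![0, 1, 1] - w • T ![0, 0, 0] ![0, 1, 1]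
      - T ![0, 0, 1] ![0, 0, 0] + (q * w) • T ![0, 0, 1] ![1, 1, 1]
      + q • T ![0, 1, 1] ![0, 0, 1]
      + (1 - w) • T ![1, 0, 0] ![0, 0, 0] - (q * w * (1 - w)) • T ![1, 0, 0] ![1, 1, 1]
      - (q * (1 - w)) • T ![1, 0, 1] ![0, 0, 1]
  | 5, 1, 4 =>
      T ![-1, 0, 1] ![0, 0, 0] - q • T ![-1, 1, 1] ![0, 0, 1] - T ![0, 0, 0] ![0, 0, 0]
      + (1 - w) • T ![0, 0, 0] ![0, 0, 1] - (1 - q) • T ![0, 0, 1] ![0, 0, 1]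
      - (q * (1 - w)) • T ![0, 0, 1] ![0, 1, 1] + q • T ![0, 1, 1] ![0, 1, 1]
      + (1 - w) • T ![1, 0, 0] ![0, 0, 1] - (q * (1 - w) * w) • T ![1, 0, 0] ![0, 1, 1]
      - (1 - w) • T ![1, 0, 1] ![0, 0, 0] - (q * (1 - w)) • T ![1, 0, 1] ![0, 1, 1]
      + (q ^ 2 * (1 - w) * w) • T ![1, 0, 1] ![1, 1, 1]
      + (1 - w) • T ![1, 1, 1] ![0, 0, 0]
      + (q * (1 - w)) • T ![1, 1, 1] ![0, 0, 1]
      + ((1 - w) * (1 - q * w)) • T ![2, 0, 0] ![0, 0, 0]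
      - (q ^ 2 * w * (1 - w) * (1 - q * w)) • T ![2, 0, 0] ![1, 1, 1]
      - ((1 - w) * (1 - q * w)) • T ![2, 0, 1] ![0, 0, 0]
      - (q * (1 - w) * (1 - q * w)) • T ![2, 0, 1] ![0, 0, 1]
      - (q ^ 2 * w * (1 - w)) • T ![2, 1, 1] ![0, 0, 1]
  | 6, 0, 4 =>
      T ![0, 0, 1] ![0, 0, 0] - q • T ![0, 1, 1] ![0, 0, 1] - T ![1, 0, 0] ![0, 0, 0]
      + (1 - q * w) • T ![1, 0, 0] ![0, 0, 1] - (1 - q) • T ![1, 0, 1] ![0, 0, 1]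
      - (q * (1 - q * w)) • T ![1, 0, 1] ![0, 1, 1] + q • T ![1, 1, 1] ![0, 1, 1]
      + (1 - q * w) • T ![2, 0, 0] ![0, 0, 1]
      - (q ^ 2 * w * (1 - q * w)) • T ![2, 0, 0] ![0, 1, 1]
      - (1 - q * w) • T ![2, 0, 1] ![0, 0, 0]
      - (q * (1 - q * w)) • T ![2, 0, 1] ![0, 1, 1]
      + (q ^ 3 * w * (1 - q * w)) • T ![2, 0, 1] ![1, 1, 1]
      + T ![2, 1, 1] ![0, 0, 0]
      + (q * (1 - q * w)) • T ![2, 1, 1] ![0, 0, 1]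
      + ((1 - q * w) * (1 - q ^ 2 * w)) • T ![3, 0, 0] ![0, 0, 0]
      - (q ^ 3 * w * (1 - q * w) * (1 - q ^ 2 * w)) • T ![3, 0, 0] ![1, 1, 1]
      - ((1 - q * w) * (1 - q ^ 2 * w)) • T ![3, 0, 1] ![0, 0, 0]
      - (q * (1 - q * w) * (1 - q ^ 2 * w)) • T ![3, 0, 1] ![0, 0, 1]
      - (q ^ 3 * w * (1 - q * w)) • T ![3, 1, 1] ![0, 0, 1]
  | _, _, _ => 0

/-- A profile with three parts. -/
abbrev Profile : Type := Fin 3 → ℕ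

/-- Cyclic shift of a profile. -/
def rotate (c : Profile) : Profile := fun i => c (i + 1)

/-- The cyclic shift `(c₁, c₂, c₃)` of the profile with `c₁ ≥ c₂` and `c₁ > c₃`; it exists and is
unique unless all three parts are equal. -/
def canon (c : Profile) : Profile :=
  if c 1 ≤ c 0 ∧ c 2 < c 0 then c
  else if (rotate c) 1 ≤ (rotate c) 0 ∧ (rotate c) 2 < (rotate c) 0 then rotate c
  else rotate (rotate c)

/-- The claimed expression for `H_c(z q ^ n, q)` (for a profile `c` of `10`) as a polynomial in
the `S₁₃(ρ | σ)`: the coefficients have `z` replaced by `z q ^ n`, and the shift of `z` in the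
series is removed by `S₁₃(z q ^ n; ρ | σ) = S₁₃(z; ρ + n δ₁ | σ)`. -/
def H (n : ℕ) (c : Profile) : Poly :=
  let d := canon c
  let w : Coeff := z * q ^ n
  let T : Vec → Vec → Poly := fun ρ σ => S (ρ + n • delta 0) σ
  if d 1 ≤ 3 ∧ d 2 ≤ 3 then overLine w T (d 1) (d 2) else underLine w T (d 0) (d 1) (d 2)

/-! ### The coupled `q`-difference equations -/

/-- `I_c`, the set of indices of the nonzero parts of `c`. -/
def supp (c : Profile) : Finset (Fin 3) := {i | c i ≠ 0}

/-- The profile `c(J)`; indices are cyclic, so that `i - 1` is the predecessor of `i`. -/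
def move (c : Profile) (J : Finset (Fin 3)) : Profile := fun i =>
  if i ∈ J ∧ i - 1 ∉ J then c i - 1
  else if i ∉ J ∧ i - 1 ∈ J then c i + 1
  else c i

/-- `(zq; q)_L = (1 - zq)(1 - zq²) ⋯ (1 - zq^L)`. -/
def poch (L : ℕ) : Coeff := ∏ j ∈ Finset.range L, (1 - z * q ^ (j + 1))

/-- The coupled relation for the profile `c`, written in terms of the `S₁₃(ρ | σ)`:
`H_c(z) - ∑_{∅ ≠ J ⊆ I_c} (-1)^{|J|-1} (zq; q)_{|J|-1} H_{c(J)}(z q^{|J|})`. -/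
def coupledRel (c : Profile) : Poly :=
  H 0 c - ∑ J ∈ (supp c).powerset with J.Nonempty,
    ((-1) ^ (J.card - 1) * poch (J.card - 1)) • H J.card (move c J)

end CylMod13

end

noncomputable section

namespace CylMod13

open Finset

/-! ### Cyclic rotations of profiles -/

/-! Everything is invariant under rotation of the profile, and 10 is not divisible by 3, so each
profile has exactly one canonical rotation; 22 canonical profiles remain. Membership in the ideal is
tested under an algebra homomorphism `φ` killing it, in the end the quotient map. There a coupled
relation becomes a linear form in finitely many elements `val φ ..`, and it suffices to exhibit it
as an explicit combination of generators, a certificate that `ring1` checks.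

Ten profiles need no generator. Those of (10,0,0), (9,0,1), (8,0,2), (7,0,3) involve only the
general formula and cancel. The relations of (7,3,0), (6,3,1), (5,3,2), (5,2,3), (6,4,0), (6,0,4)
can be solved in turn for the six explicit expressions, those of (6,4,0), (5,4,1), (4,4,2), (5,1,4),
(5,5,0), (6,0,4), every other term being known by then; the explicit formulas are these solutions.

The other twelve profiles impose genuine conditions and carry the proof. Their certificates only use
generators at points with entries between -2 and 5, inside the box of size 6. -/

theorem rotate_cons (a b c : ℕ) : rotate ![a, b, c] = ![b, c, a] := by
  funext i
  fin_cases i <;> rfl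

/-- The total 10 rules out three equal parts, the only case in which no rotation is canonical. -/
theorem canon_rotate (c : Profile) (hc : c 0 + c 1 + c 2 = 10) : canon (rotate c) = canon c := by
  obtain ⟨a, b, d, rfl⟩ : ∃ a b d, c = ![a, b, d] :=
    ⟨c 0, c 1, c 2, by funext i; fin_cases i <;> rfl⟩
  simp only [Matrix.cons_val] at hc
  simp only [canon, rotate_cons, Matrix.cons_val]
  split_ifs <;> first | rfl | omega

theorem H_rotate (n : ℕ) (c : Profile) (hc : c 0 + c 1 + c 2 = 10) : H n (rotate c) = H n c := by
  simp only [H, canon_rotate c hc]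

theorem mem_supp (c : Profile) (i : Fin 3) : i ∈ supp c ↔ c i ≠ 0 := by
  simp [supp]

/-- Around the cycle, `J` is entered as often as it is left, so decrements and increments balance;
`J ⊆ supp c` keeps the natural subtraction from truncating. -/
theorem sum_move (c : Profile) (J : Finset (Fin 3)) (hJ : J ⊆ supp c) :
    move c J 0 + move c J 1 + move c J 2 = c 0 + c 1 + c 2 := by
  have h : ∀ i ∈ J, 0 < c i := fun i hi => Nat.pos_of_ne_zero ((mem_supp c i).1 (hJ hi))
  have h0 := h 0
  have h1 := h 1
  have h2 := h 2
  have e0 : (0 : Fin 3) - 1 = 2 := rfl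
  have e1 : (1 : Fin 3) - 1 = 0 := rfl
  have e2 : (2 : Fin 3) - 1 = 1 := rfl
  simp only [move, e0, e1, e2]
  by_cases m0 : (0 : Fin 3) ∈ J <;> by_cases m1 : (1 : Fin 3) ∈ J <;>
    by_cases m2 : (2 : Fin 3) ∈ J <;> simp [m0, m1, m2] at h0 h1 h2 ⊢ <;> omega

/-- The cyclic shift of index sets that corresponds to `rotate`. -/
def shiftSet (J : Finset (Fin 3)) : Finset (Fin 3) := J.map (Equiv.addRight (-1)).toEmbedding

theorem mem_shiftSet (J : Finset (Fin 3)) (i : Fin 3) : i ∈ shiftSet J ↔ i + 1 ∈ J := by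
  simp [shiftSet, Finset.mem_map_equiv]

theorem card_shiftSet (J : Finset (Fin 3)) : (shiftSet J).card = J.card := card_map _

theorem move_rotate (c : Profile) (J : Finset (Fin 3)) :
    move (rotate c) (shiftSet J) = rotate (move c J) := by
  funext i
  simp only [move, rotate, mem_shiftSet, sub_add_cancel, add_sub_cancel_right]

/-- The bijection `shiftSet` of index sets preserves cardinality, hence the sign, the Pochhammer
factor and the shift of `z`, while the moved profile is merely rotated. -/
theorem coupledRel_rotate (c : Profile) (hc : c 0 + c 1 + c 2 = 10) :
    coupledRel (rotate c) = coupledRel c := by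
  unfold coupledRel
  rw [H_rotate 0 c hc]
  congr 1
  symm
  refine Finset.sum_bij (fun J _ => shiftSet J) ?_ ?_ ?_ ?_
  · intro J hJ
    rw [mem_filter, mem_powerset] at hJ ⊢
    refine ⟨fun i hi => ?_, by simpa [shiftSet] using hJ.2⟩
    exact (mem_supp _ _).2 ((mem_supp c _).1 (hJ.1 ((mem_shiftSet J i).1 hi)))
  · intro J _ K _ h
    exact map_injective _ h
  · intro K hK
    rw [mem_filter, mem_powerset] at hK
    have hK' : shiftSet (K.map (Equiv.addRight 1).toEmbedding) = K := by
      ext i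
      simp [mem_shiftSet, Finset.mem_map_equiv]
    refine ⟨K.map (Equiv.addRight 1).toEmbedding, ?_, hK'⟩
    rw [mem_filter, mem_powerset]
    refine ⟨fun i hi => ?_, by simpa using hK.2⟩
    have hi' : i - 1 ∈ K := by simpa [Finset.mem_map_equiv, sub_eq_add_neg] using hi
    have := (mem_supp _ _).1 (hK.1 hi')
    rw [mem_supp]
    simpa [rotate] using this
  · intro J hJ
    rw [mem_filter, mem_powerset] at hJ
    simp only [card_shiftSet, move_rotate]
    rw [H_rotate _ _ ((sum_move c J hJ.1).trans hc)]

/-! ### The coupled relations term by term -/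

/-- Writing the parts as successors lets the subtractions in `move` compute by `rfl`. The remaining
support patterns of canonical profiles follow. -/
theorem coupledRel_pos (a b c : ℕ) :
    coupledRel ![a + 1, b + 1, c + 1] =
      H 0 ![a + 1, b + 1, c + 1]
      - (H 1 ![a, b + 2, c + 1] + H 1 ![a + 1, b, c + 2] + H 1 ![a + 2, b + 1, c])
      + (1 - z * q) • (H 2 ![a, b + 1, c + 2] + H 2 ![a + 2, b, c + 1] + H 2 ![a + 1, b + 2, c])
      - ((1 - z * q) * (1 - z * q ^ 2)) • H 3 ![a + 1, b + 1, c + 1] := by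
  have hs : supp ![a + 1, b + 1, c + 1] = {0, 1, 2} := by
    ext i
    fin_cases i <;> simp [supp]
  have hp : (({0, 1, 2} : Finset (Fin 3)).powerset.filter (·.Nonempty)) =
      {{0}, {1}, {2}, {0, 1}, {1, 2}, {0, 2}, {0, 1, 2}} := by decide
  have m0 : move ![a + 1, b + 1, c + 1] {0} = ![a, b + 2, c + 1] := by
    funext i; fin_cases i <;> rfl
  have m1 : move ![a + 1, b + 1, c + 1] {1} = ![a + 1, b, c + 2] := by
    funext i; fin_cases i <;> rfl
  have m2 : move ![a + 1, b + 1, c + 1] {2} = ![a + 2, b + 1, c] := by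
    funext i; fin_cases i <;> rfl
  have m01 : move ![a + 1, b + 1, c + 1] {0, 1} = ![a, b + 1, c + 2] := by
    funext i; fin_cases i <;> rfl
  have m12 : move ![a + 1, b + 1, c + 1] {1, 2} = ![a + 2, b, c + 1] := by
    funext i; fin_cases i <;> rfl
  have m02 : move ![a + 1, b + 1, c + 1] {0, 2} = ![a + 1, b + 2, c] := by
    funext i; fin_cases i <;> rfl
  -- With all indices in `J`, every predecessor also lies in `J`, so the profile returns to itself.
  have m012 : move ![a + 1, b + 1, c + 1] {0, 1, 2} = ![a + 1, b + 1, c + 1] := by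
    funext i; fin_cases i <;> rfl
  rw [coupledRel, hs, hp]
  rw [sum_insert (by decide), sum_insert (by decide), sum_insert (by decide),
    sum_insert (by decide), sum_insert (by decide), sum_insert (by decide), sum_singleton,
    m0, m1, m2, m01, m12, m02, m012]
  simp [poch, prod_range_succ, smul_add, sub_smul]
  abel

theorem coupledRel_right_zero (a b : ℕ) :
    coupledRel ![a + 1, b + 1, 0] =
      H 0 ![a + 1, b + 1, 0] - (H 1 ![a, b + 2, 0] + H 1 ![a + 1, b, 1])
      + (1 - z * q) • H 2 ![a, b + 1, 1] := by
  have hs : supp ![a + 1, b + 1, 0] = {0, 1} := by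
    ext i
    fin_cases i <;> simp [supp]
  have hp : (({0, 1} : Finset (Fin 3)).powerset.filter (·.Nonempty)) = {{0}, {1}, {0, 1}} := by
    decide
  have m0 : move ![a + 1, b + 1, 0] {0} = ![a, b + 2, 0] := by
    funext i; fin_cases i <;> rfl
  have m1 : move ![a + 1, b + 1, 0] {1} = ![a + 1, b, 1] := by
    funext i; fin_cases i <;> rfl
  have m01 : move ![a + 1, b + 1, 0] {0, 1} = ![a, b + 1, 1] := by
    funext i; fin_cases i <;> rfl
  rw [coupledRel, hs, hp, sum_insert (by decide), sum_insert (by decide), sum_singleton,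
    m0, m1, m01]
  simp [poch, sub_smul]
  abel

theorem coupledRel_mid_zero (a c : ℕ) :
    coupledRel ![a + 1, 0, c + 1] =
      H 0 ![a + 1, 0, c + 1] - (H 1 ![a, 1, c + 1] + H 1 ![a + 2, 0, c])
      + (1 - z * q) • H 2 ![a + 1, 1, c] := by
  have hs : supp ![a + 1, 0, c + 1] = {0, 2} := by
    ext i
    fin_cases i <;> simp [supp]
  have hp : (({0, 2} : Finset (Fin 3)).powerset.filter (·.Nonempty)) = {{0}, {2}, {0, 2}} := by
    decide
  have m0 : move ![a + 1, 0, c + 1] {0} = ![a, 1, c + 1] := by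
    funext i; fin_cases i <;> rfl
  have m1 : move ![a + 1, 0, c + 1] {2} = ![a + 2, 0, c] := by
    funext i; fin_cases i <;> rfl
  have m01 : move ![a + 1, 0, c + 1] {0, 2} = ![a + 1, 1, c] := by
    funext i; fin_cases i <;> rfl
  rw [coupledRel, hs, hp, sum_insert (by decide), sum_insert (by decide), sum_singleton,
    m0, m1, m01]
  simp [poch, sub_smul]
  abel

theorem coupledRel_mid_right_zero (a : ℕ) :
    coupledRel ![a + 1, 0, 0] = H 0 ![a + 1, 0, 0] - H 1 ![a, 1, 0] := by
  have hs : supp ![a + 1, 0, 0] = {0} := by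
    ext i
    fin_cases i <;> simp [supp]
  have hp : (({0} : Finset (Fin 3)).powerset.filter (·.Nonempty)) = {{0}} := by decide
  have m0 : move ![a + 1, 0, 0] {0} = ![a, 1, 0] := by
    funext i; fin_cases i <;> rfl
  rw [coupledRel, hs, hp, sum_singleton, m0]
  simp [poch]

/-! ### Evaluating the expressions `H` -/

/-- `S₁₃(z q ^ n; ρ | σ)` written in terms of the variables `S₁₃(ρ | σ)`. -/
def shiftedS (n : ℕ) (ρ σ : Vec) : Poly := S (ρ + n • delta 0) σ

-- This and its two rotated forms all match a literal profile, but only one canonical rotation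
-- exists, so `simp` can discharge the side conditions of just one of them.
@[simp]
theorem H_of_canonical (n : ℕ) {a b c : ℕ} (h : b ≤ a ∧ c < a) :
    H n ![a, b, c] =
      if b ≤ 3 ∧ c ≤ 3 then overLine (z * q ^ n) (shiftedS n) b c
      else underLine (z * q ^ n) (shiftedS n) a b c := by
  have hc : canon ![a, b, c] = ![a, b, c] := if_pos h
  simp only [H, hc]
  rfl

@[simp]
theorem H_of_canonical_rotate (n : ℕ) {a b c : ℕ} (h : b ≤ a ∧ c < a) (hs : a + b + c = 10) :
    H n ![b, c, a] =
      if b ≤ 3 ∧ c ≤ 3 then overLine (z * q ^ n) (shiftedS n) b c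
      else underLine (z * q ^ n) (shiftedS n) a b c := by
  rw [← H_of_canonical n h, ← rotate_cons, H_rotate _ _ hs]

@[simp]
theorem H_of_canonical_rotate_rotate (n : ℕ) {a b c : ℕ} (h : b ≤ a ∧ c < a)
    (hs : a + b + c = 10) :
    H n ![c, a, b] =
      if b ≤ 3 ∧ c ≤ 3 then overLine (z * q ^ n) (shiftedS n) b c
      else underLine (z * q ^ n) (shiftedS n) a b c := by
  rw [← H_of_canonical_rotate n h hs, ← rotate_cons, H_rotate]
  rw [← hs]
  exact (add_comm _ _).trans (add_assoc _ _ _).symm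

@[simp]
theorem e_zero : e 0 = ![1, 1, 1] := by funext i; fin_cases i <;> rfl
@[simp]
theorem e_one : e 1 = ![0, 1, 1] := by funext i; fin_cases i <;> rfl
@[simp]
theorem e_two : e 2 = ![0, 0, 1] := by funext i; fin_cases i <;> rfl
@[simp]
theorem e_three : e 3 = ![0, 0, 0] := by funext i; fin_cases i <;> rfl


/-! ### Homomorphisms that kill the relations -/

variable {B : Type*} [CommRing B] [Algebra Coeff B]

/-- The image of `S₁₃(a b c | d e f)` under an algebra homomorphism. -/
def val (φ : Poly →ₐ[Coeff] B) (a b c d e f : ℤ) : B := φ (S ![a, b, c] ![d, e, f])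

@[simp]
theorem map_shiftedS (φ : Poly →ₐ[Coeff] B) (n : ℕ) (a b c d e f : ℤ) :
    φ (shiftedS n ![a, b, c] ![d, e, f]) = val φ (a + n) b c d e f := by
  unfold val shiftedS
  congr 2
  funext i
  fin_cases i <;> simp [delta]

-- Scalars become factors in `B`, so that the goals are identities in a commutative ring. It
-- replaces `map_smul`, which is therefore switched off below.
@[simp]
theorem map_coeff_smul (φ : Poly →ₐ[Coeff] B) (a : Coeff) (x : Poly) :
    φ (a • x) = algebraMap Coeff B a * φ x := by
  rw [map_smul, Algebra.smul_def]

@[simp]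
theorem qpow_of_nonneg {n : ℤ} (hn : 0 ≤ n) : qpow n = q ^ n.toNat := by
  lift n to ℕ using hn
  simp [qpow]

/-- The only negative power that occurs is `qpow (-1)`: from the coefficient `z/q` for the profile
(5,5,0), and from `R1` at a point with first entry -2. It stays an atom, and this equation
eliminates it. -/
theorem q_mul_qpow_neg_one : q * qpow (-1) = 1 := by
  simp [qpow]

theorem map_q_mul_map_qpow_neg_one (B : Type*) [CommRing B] [Algebra Coeff B] :
    algebraMap Coeff B q * algebraMap Coeff B (qpow (-1)) = 1 := by
  rw [← map_mul, q_mul_qpow_neg_one, map_one]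

/-! ### The relations in the image of a homomorphism that kills `I_{13,6}` -/

/-- The homomorphism `φ` kills all the relations that generate `I_{13,6}`. -/
def KillsRelations (φ : Poly →ₐ[Coeff] B) : Prop := ∀ f ∈ relIdeal 6, φ f = 0

/-- All six integers lie in `{-6, …, 6}`. -/
abbrev InBox (a b c d e f : ℤ) : Prop :=
  ((-6 ≤ a ∧ a ≤ 6) ∧ (-6 ≤ b ∧ b ≤ 6) ∧ (-6 ≤ c ∧ c ≤ 6)) ∧
    (-6 ≤ d ∧ d ≤ 6) ∧ (-6 ≤ e ∧ e ≤ 6) ∧ (-6 ≤ f ∧ f ≤ 6)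

theorem mem_Icc_of_inBox {a b c d e f : ℤ} (h : InBox a b c d e f) :
    (∀ j, (![a, b, c] : Vec) j ∈ Set.Icc (-((6 : ℕ) : ℤ)) (6 : ℕ)) ∧
      ∀ j, (![d, e, f] : Vec) j ∈ Set.Icc (-((6 : ℕ) : ℤ)) (6 : ℕ) := by
  obtain ⟨⟨ha, hb, hc⟩, hd, he, hf⟩ := h
  constructor <;> intro j <;> fin_cases j <;> assumption

/-! ### Partial sums and shift vectors in coordinates -/

theorem prefixSum_one (a b c : ℤ) : prefixSum 1 ![a, b, c] = a := by
  simp [prefixSum]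

theorem prefixSum_two (a b c : ℤ) : prefixSum 2 ![a, b, c] = a + b := by
  simp [prefixSum, Fin.sum_univ_three]

theorem prefixSum_three (a b c : ℤ) : prefixSum 3 ![a, b, c] = a + b + c := by
  simp [prefixSum, Fin.sum_univ_three]

theorem prefixVec_one : prefixVec 1 = ![1, 0, 0] := by funext i; fin_cases i <;> rfl
theorem prefixVec_two : prefixVec 2 = ![1, 1, 0] := by funext i; fin_cases i <;> rfl
theorem prefixVec_three : prefixVec 3 = ![1, 1, 1] := by funext i; fin_cases i <;> rfl
theorem delta_zero : delta 0 = ![1, 0, 0] := by funext i; fin_cases i <;> rfl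
theorem delta_one : delta 1 = ![0, 1, 0] := by funext i; fin_cases i <;> rfl
theorem delta_two : delta 2 = ![0, 0, 1] := by funext i; fin_cases i <;> rfl

theorem map_S (φ : Poly →ₐ[Coeff] B) (a b c d e f : ℤ) :
    φ (S ![a, b, c] ![d, e, f]) = val φ a b c d e f := rfl

local notation "𝐪" => algebraMap Coeff B q
local notation "𝐳" => algebraMap Coeff B z

variable {φ : Poly →ₐ[Coeff] B}

namespace KillsRelations

/-- The relation `R₁^{(1)}` at `(a b c | d e f)`. -/
theorem r₁₁ (h : KillsRelations φ) (a b c d e f : ℤ) (hb : InBox a b c d e f := by decide) :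
    val φ a b c d e f - val φ (a + 1) (b - 1) c d e f
      - 𝐳 * algebraMap Coeff B (qpow (1 + a)) * val φ (a + 2) b c (d - 1) e f = 0 := by
  have := h (R1 0 ![a, b, c] ![d, e, f]) (Ideal.subset_span
    ⟨_, _, (mem_Icc_of_inBox hb).1, (mem_Icc_of_inBox hb).2, .inl ⟨0, rfl⟩⟩)
  simpa [R1, map_S, prefixSum_one, prefixVec_one, delta_zero, delta_one, -map_smul] using this

/-- The relation `R₁^{(2)}` at `(a b c | d e f)`. -/
theorem r₁₂ (h : KillsRelations φ) (a b c d e f : ℤ) (hb : InBox a b c d e f := by decide) :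
    val φ a b c d e f - val φ a (b + 1) (c - 1) d e f
      - 𝐳 * algebraMap Coeff B (qpow (2 + (a + b))) *
        val φ (a + 2) (b + 2) c (d - 1) (e - 1) f = 0 := by
  have := h (R1 1 ![a, b, c] ![d, e, f]) (Ideal.subset_span
    ⟨_, _, (mem_Icc_of_inBox hb).1, (mem_Icc_of_inBox hb).2, .inl ⟨1, rfl⟩⟩)
  simpa [R1, map_S, prefixSum_two, prefixVec_two, delta_one, delta_two, -map_smul] using this

/-- The relation `R₂^{(1)}` at `(a b c | d e f)`. -/
theorem r₂₁ (h : KillsRelations φ) (a b c d e f : ℤ) (hb : InBox a b c d e f := by decide) :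
    val φ a b c d e f - val φ a b c (d + 1) (e - 1) f
      - algebraMap Coeff B (qpow (1 + d)) * val φ (a - 1) b c (d + 2) e f = 0 := by
  have := h (R2 0 ![a, b, c] ![d, e, f]) (Ideal.subset_span
    ⟨_, _, (mem_Icc_of_inBox hb).1, (mem_Icc_of_inBox hb).2, .inr (.inl ⟨0, rfl⟩)⟩)
  simpa [R2, map_S, prefixSum_one, prefixVec_one, delta_zero, delta_one, -map_smul] using this

/-- The relation `R₂^{(2)}` at `(a b c | d e f)`. -/
theorem r₂₂ (h : KillsRelations φ) (a b c d e f : ℤ) (hb : InBox a b c d e f := by decide) :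
    val φ a b c d e f - val φ a b c d (e + 1) (f - 1)
      - algebraMap Coeff B (qpow (2 + (d + e))) *
        val φ (a - 1) (b - 1) c (d + 2) (e + 2) f = 0 := by
  have := h (R2 1 ![a, b, c] ![d, e, f]) (Ideal.subset_span
    ⟨_, _, (mem_Icc_of_inBox hb).1, (mem_Icc_of_inBox hb).2, .inr (.inl ⟨1, rfl⟩)⟩)
  simpa [R2, map_S, prefixSum_two, prefixVec_two, delta_one, delta_two, -map_smul] using this

/-- The relation `R₃` at `(a b c | d e f)`. -/
theorem r₃ (h : KillsRelations φ) (a b c d e f : ℤ) (hb : InBox a b c d e f := by decide) :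
    val φ a b c d e f - val φ a b c d e (f + 1) - 𝐪 * val φ a b (c + 1) d e (f + 1)
      + 𝐪 * val φ a b (c + 1) d e (f + 2)
      - algebraMap Coeff B (qpow (3 + (d + e + f))) *
        val φ (a - 1) (b - 1) (c - 1) (d + 2) (e + 2) (f + 2) = 0 := by
  have := h (R3 ![a, b, c] ![d, e, f]) (Ideal.subset_span
    ⟨_, _, (mem_Icc_of_inBox hb).1, (mem_Icc_of_inBox hb).2, .inr (.inr (.inl rfl))⟩)
  simpa [R3, map_S, prefixSum_three, prefixVec_three, delta_two, -map_smul] using this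

/-- The relation `R₄` at `(a b c | d e f)`. -/
theorem r₄ (h : KillsRelations φ) (a b c d e f : ℤ) (hb : InBox a b c d e f := by decide) :
    val φ a b c d e f - val φ a b (c + 1) d e f - 𝐪 * val φ a b (c + 1) d e (f + 1)
      + 𝐪 * val φ a b (c + 2) d e (f + 1)
      - 𝐳 * algebraMap Coeff B (qpow (3 + (a + b + c))) *
        val φ (a + 2) (b + 2) (c + 2) (d - 1) (e - 1) (f - 1) = 0 := by
  have := h (R4 ![a, b, c] ![d, e, f]) (Ideal.subset_span
    ⟨_, _, (mem_Icc_of_inBox hb).1, (mem_Icc_of_inBox hb).2, .inr (.inr (.inr rfl))⟩)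
  simpa [R4, map_S, prefixSum_three, prefixVec_three, delta_two, -map_smul] using this

end KillsRelations

theorem killsRelations_mk : KillsRelations (B := Poly ⧸ relIdeal 6)
    (Ideal.Quotient.mkₐ Coeff (relIdeal 6)) :=
  fun _ hf => Ideal.Quotient.eq_zero_iff_mem.2 hf

/-! ### The coupled relations of the canonical profiles

Each of them is written as an explicit linear combination of relations inside the box. -/

theorem map_coupledRel_9_1_0 (h : KillsRelations φ) : φ (coupledRel ![9, 1, 0]) = 0 := by
  rw [coupledRel_right_zero]
  simp [overLine, -map_smul]
  -- A single generator suffices here. `simp` evaluates the indices and the exponents of `q`, so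
  -- that equal values of `val` become the same atom for `ring1`; all later certificates are checked
  -- this way.
  linear_combination (norm := (simp; ring1))
    (h.r₁₁ 0 1 1 1 1 1)

theorem map_coupledRel_8_2_0 (h : KillsRelations φ) : φ (coupledRel ![8, 2, 0]) = 0 := by
  rw [coupledRel_right_zero]
  simp [overLine, -map_smul]
  linear_combination (norm := (simp; ring1))
    (h.r₁₁ 0 0 1 1 1 1 + h.r₁₂ 1 (-1) 1 1 1 1 - h.r₁₁ 1 1 1 0 1 1)
    + 𝐪 ^ 2 * 𝐳 * (-h.r₂₁ 3 1 1 (-1) 1 1)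

theorem map_coupledRel_8_1_1 (h : KillsRelations φ) : φ (coupledRel ![8, 1, 1]) = 0 := by
  rw [coupledRel_pos]
  simp [overLine, -map_smul]
  linear_combination (norm := (simp; ring1))
    (h.r₁₁ 0 1 1 0 1 1)
    + 𝐪 * 𝐳 * (h.r₂₁ 2 1 1 (-1) 1 1)
    + (1 - 𝐪 * 𝐳) * (-h.r₁₁ 1 1 1 1 1 1)

theorem map_coupledRel_7_2_1 (h : KillsRelations φ) : φ (coupledRel ![7, 2, 1]) = 0 := by
  rw [coupledRel_pos]
  simp [overLine, -map_smul]
  linear_combination (norm := (simp; ring1))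
    (h.r₁₁ 0 0 1 0 1 1 + h.r₁₂ 1 (-1) 1 0 1 1 - h.r₁₁ 1 1 1 0 0 1)
    + 𝐪 * (-h.r₁₁ 0 1 1 1 1 1)
    + 𝐪 * 𝐳 * (h.r₂₁ 2 0 1 (-1) 1 1)
    + (1 - 𝐪 * 𝐳) * (h.r₁₁ 2 1 1 0 1 1 - h.r₁₁ 1 0 1 1 1 1 - h.r₁₂ 2 (-1) 1 1 1 1)
    + 𝐪 ^ 3 * 𝐳 * (1 - 𝐪 * 𝐳) * (h.r₂₁ 4 1 1 (-1) 1 1)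

theorem map_coupledRel_7_1_2 (h : KillsRelations φ) : φ (coupledRel ![7, 1, 2]) = 0 := by
  rw [coupledRel_pos]
  simp [overLine, -map_smul]
  linear_combination (norm := (simp; ring1))
    (h.r₁₁ 0 1 1 0 0 1 - h.r₁₁ 1 1 1 0 1 1)
    + 𝐪 * 𝐳 * (h.r₁₁ 1 1 1 1 0 1 + h.r₂₁ 2 1 1 (-1) 0 1 + h.r₂₂ 2 1 1 0 (-1) 1
      - h.r₂₁ 2 0 1 0 1 1)
    + 𝐪 ^ 2 * 𝐳 * (-h.r₂₁ 3 1 1 (-1) 1 1)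

/-- An identity up to `q * q⁻¹ = 1`, where `q⁻¹` comes from the expression for (5,5,0) evaluated at
`z * q`. -/
theorem map_coupledRel_6_4_0 (φ : Poly →ₐ[Coeff] B) : φ (coupledRel ![6, 4, 0]) = 0 := by
  rw [coupledRel_right_zero]
  simp [overLine, underLine, -map_smul]
  linear_combination 𝐳 * val φ 1 0 0 0 1 1 * map_q_mul_map_qpow_neg_one B

theorem map_coupledRel_6_2_2 (h : KillsRelations φ) : φ (coupledRel ![6, 2, 2]) = 0 := by
  rw [coupledRel_pos]
  simp [overLine, -map_smul]
  linear_combination (norm := (simp; ring1))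
    (h.r₁₁ 0 0 1 0 0 1 + h.r₁₂ 1 (-1) 1 0 0 1 + h.r₂₂ 1 1 1 0 (-1) 1 - h.r₁₁ 1 1 1 0 (-1) 1
      - h.r₂₁ 1 0 1 0 1 1)
    + 𝐪 * (-h.r₁₁ 0 1 1 0 1 1)
    + 𝐪 * 𝐳 * (h.r₂₁ 2 0 1 (-1) 0 1)
    + 𝐪 ^ 2 * 𝐳 * (-h.r₂₁ 2 1 1 (-1) 1 1)
    + (1 - 𝐪 * 𝐳) * (h.r₁₁ 2 1 1 0 0 1 + h.r₂₁ 2 (-1) 1 0 1 1 - h.r₁₁ 1 0 1 1 0 1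
      - h.r₁₂ 2 (-1) 1 0 1 1 - h.r₂₂ 2 0 1 0 (-1) 1)
    + 𝐪 * (1 - 𝐪 * 𝐳) * (h.r₁₁ 1 1 1 1 1 1)

theorem map_coupledRel_6_1_3 (h : KillsRelations φ) : φ (coupledRel ![6, 1, 3]) = 0 := by
  rw [coupledRel_pos]
  simp [overLine, underLine, -map_smul]
  linear_combination (norm := (simp; ring1))
    (h.r₁₁ 0 1 1 0 0 0)
    + 𝐪 * 𝐳 * (h.r₁₁ 1 1 1 1 0 0 + h.r₁₁ 2 1 1 0 (-1) 0 + h.r₂₁ 2 1 1 (-1) 0 0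
      - h.r₁₁ 1 0 1 0 0 0 - h.r₁₂ 2 (-1) 1 0 0 0)
    + 𝐪 ^ 3 * 𝐳 ^ 2 * (-h.r₂₁ 3 0 1 (-1) 0 0)
    + (1 - 𝐪 ^ 2 * 𝐳) * (-h.r₁₁ 1 1 1 0 0 1)
    + 𝐪 * 𝐳 * (1 - 𝐪 ^ 2 * 𝐳) * (h.r₁₁ 2 0 1 1 0 0 + h.r₁₁ 3 1 0 0 0 0 + h.r₁₂ 3 (-1) 1 0 1 0
      + h.r₁₂ 3 0 1 0 0 0 + h.r₂₂ 3 0 1 0 (-1) 0 + h.r₃ 3 0 1 0 0 (-1) + h.r₃ 3 0 1 0 0 0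
      - h.r₁₁ 2 0 0 0 0 1 - h.r₁₁ 3 1 1 0 0 0 - h.r₁₂ 3 (-1) 0 0 0 1 - h.r₂₁ 3 (-1) 1 0 1 0
      - h.r₂₂ 3 0 0 0 0 1 - h.r₄ 3 0 (-1) 0 0 1 - h.r₄ 3 0 0 0 0 1)
    + 𝐪 ^ 2 * 𝐳 * (1 - 𝐪 ^ 2 * 𝐳) * (h.r₁₁ 2 0 1 0 1 1 + h.r₁₂ 3 (-1) 1 0 1 1
      + h.r₁₂ 3 0 2 0 0 0 + h.r₂₁ 3 0 1 0 1 1 - h.r₁₁ 2 1 1 1 0 1 - h.r₁₁ 3 1 1 0 0 1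
      - h.r₂₁ 3 1 1 (-1) 0 1 - h.r₂₂ 3 0 0 0 0 2 - h.r₂₂ 3 1 1 0 (-1) 1)
    + 𝐪 ^ 4 * 𝐳 ^ 2 * (1 - 𝐪 ^ 2 * 𝐳) * (h.r₂₁ 3 0 0 0 1 1 - h.r₂₁ 4 0 0 (-1) 0 1
      - h.r₂₂ 4 0 0 0 (-1) 1)
    + 𝐪 ^ 5 * 𝐳 ^ 2 * (1 - 𝐪 ^ 2 * 𝐳) * (h.r₁₁ 2 0 0 2 1 1 + h.r₂₁ 4 0 1 (-1) 1 1
      - h.r₂₂ 5 1 0 (-1) (-1) 1)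

theorem map_coupledRel_5_5_0 (h : KillsRelations φ) : φ (coupledRel ![5, 5, 0]) = 0 := by
  rw [coupledRel_right_zero]
  simp [underLine, -map_smul]
  linear_combination (norm := (simp; ring1))
    (h.r₁₁ (-2) 0 0 1 1 1 + h.r₁₁ (-1) (-1) 0 1 1 1 + h.r₁₂ 0 (-2) 0 1 1 1
      + h.r₂₁ 1 (-1) 1 (-1) 0 1 + h.r₂₂ 1 (-1) 1 0 (-1) 1 + h.r₂₂ 1 0 1 (-1) (-1) 0
      + h.r₃ 1 0 1 (-1) 0 (-1) + h.r₄ 0 (-1) (-1) 1 1 1 + h.r₄ 0 (-1) 0 1 1 1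
      - h.r₁₁ (-1) 0 1 1 0 1 - h.r₂₁ (-1) 0 1 0 1 1 - h.r₂₁ 1 (-1) 1 (-1) 1 0
      - h.r₂₂ 1 (-1) 1 (-1) 0 1 - h.r₂₂ 1 0 1 (-1) (-1) 1 - h.r₃ 1 0 1 (-1) (-1) 0)
    + 𝐳 * (-h.r₁₁ 0 0 0 0 1 1)
    + 𝐪 * (h.r₁₁ (-1) 1 1 1 1 1 + h.r₂₂ 1 0 2 (-1) (-1) 2 - h.r₁₁ (-2) 0 1 2 1 1
      - h.r₁₁ (-1) (-1) 1 2 1 1 - h.r₁₂ 0 (-2) 1 1 2 1 - h.r₁₂ 0 (-1) 2 1 1 1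
      - h.r₂₂ 1 0 2 (-1) (-1) 1)
    + 𝐪 * 𝐳 * (h.r₁₁ 0 0 1 1 1 1 + h.r₁₁ 2 1 1 0 (-1) 0 + h.r₂₁ 2 0 1 0 1 0 + h.r₂₂ 2 0 1 0 0 1
      - h.r₁₁ 1 0 1 0 0 0 - h.r₁₂ 2 (-1) 1 0 0 0 - h.r₂₂ 2 1 1 0 (-1) 0 - h.r₃ 2 1 1 0 0 (-1))
    + 𝐪 * 𝐳 ^ 2 * (-h.r₂₁ 2 0 0 (-1) 1 1)
    + 𝐪 ^ 2 * 𝐳 * (h.r₁₁ 1 1 1 0 0 1 - h.r₂₁ 2 1 1 0 1 1)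
    + 𝐪 ^ 3 * 𝐳 * (h.r₁₂ 1 (-1) 1 2 2 1 - h.r₁₁ 1 1 1 2 1 1)
    + 𝐪 ^ 3 * 𝐳 ^ 2 * (-h.r₂₁ 3 0 1 (-1) 0 0)
    + 𝐪 ^ 4 * 𝐳 ^ 2 * (h.r₂₁ 3 1 1 (-1) 0 1 + h.r₂₂ 3 1 1 0 (-1) 1)
    + 𝐪 * 𝐳 * (1 - 𝐪 ^ 2 * 𝐳) * (h.r₁₁ 2 0 1 1 0 0 + h.r₁₂ 3 (-1) 1 0 1 0 + h.r₁₂ 3 0 1 0 0 0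
      + h.r₂₂ 3 0 1 0 (-1) 0 + h.r₃ 3 0 1 0 0 (-1) + h.r₃ 3 0 1 0 0 0 - h.r₁₁ 2 0 0 0 0 1
      - h.r₁₁ 3 1 1 0 0 0 - h.r₁₂ 3 (-1) 0 0 0 1 - h.r₂₁ 3 (-1) 1 0 1 0 - h.r₂₂ 3 0 0 0 0 1
      - h.r₄ 3 0 (-1) 0 0 1 - h.r₄ 3 0 0 0 0 1)
    + 𝐪 ^ 2 * 𝐳 * (1 - 𝐪 ^ 2 * 𝐳) * (h.r₁₁ 2 0 1 0 1 1 + h.r₁₂ 3 (-1) 1 0 1 1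
      + h.r₁₂ 3 0 2 0 0 0 + h.r₂₁ 3 0 1 0 1 1 - h.r₁₁ 2 1 1 1 0 1 - h.r₁₁ 3 1 1 0 0 1
      - h.r₂₂ 3 0 0 0 0 2)
    + 𝐪 ^ 4 * 𝐳 ^ 2 * (1 - 𝐪 ^ 2 * 𝐳) * (h.r₁₁ 3 1 0 0 (-1) 1 + h.r₂₁ 3 0 0 0 1 1
      - h.r₂₁ 4 0 0 (-1) 0 1 - h.r₂₂ 3 1 0 0 (-1) 1)
    + 𝐪 ^ 5 * 𝐳 ^ 2 * (1 - 𝐪 ^ 2 * 𝐳) * (h.r₂₁ 4 0 1 (-1) 1 1)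
    + 𝐪 * 𝐳 * (1 - 𝐪 ^ 2 * 𝐳 - 𝐪 ^ 3 * 𝐳 + 𝐪 ^ 5 * 𝐳 ^ 2) * (h.r₁₁ 3 1 0 0 0 0)
    + 𝐪 ^ 5 * 𝐳 ^ 2 * (1 - 𝐪 ^ 2 * 𝐳 - 𝐪 ^ 3 * 𝐳 + 𝐪 ^ 5 * 𝐳 ^ 2) * (
      -h.r₂₂ 5 1 0 (-1) (-1) 1)
    -- Removes the product `q * q⁻¹` produced by `q` times the generator `r₁₁ (-2) 0 1 2 1 1`.
    - 𝐳 * val φ 0 0 1 1 1 1 * map_q_mul_map_qpow_neg_one B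

theorem map_coupledRel_5_4_1 (h : KillsRelations φ) : φ (coupledRel ![5, 4, 1]) = 0 := by
  rw [coupledRel_pos]
  simp [overLine, underLine, -map_smul]
  linear_combination (norm := (simp; ring1))
    (h.r₁₁ (-1) 0 0 0 1 1 + h.r₁₁ 0 0 1 1 0 0 + h.r₁₂ 0 (-1) 0 0 1 1 + h.r₁₂ 1 (-1) 1 0 1 0
      + h.r₂₁ 0 0 (-1) 0 1 1 + h.r₂₁ 1 0 1 (-1) 0 0 + h.r₂₁ 1 0 1 0 1 0 + h.r₂₂ 1 0 1 0 (-1) 0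
      + h.r₂₂ 1 0 1 0 0 1 + h.r₃ 1 0 1 0 0 (-1) + h.r₄ 0 0 (-1) 1 0 1 + h.r₄ 0 0 0 1 0 1
      - h.r₁₁ 0 0 1 0 0 0 - h.r₁₁ 0 0 1 0 0 1 - h.r₁₂ 1 (-1) 1 0 0 0 - h.r₁₂ 1 (-1) 1 0 0 1
      - h.r₂₁ 1 (-1) 1 0 1 0 - h.r₂₁ 1 0 1 (-1) 0 1 - h.r₂₂ 1 0 0 0 0 1 - h.r₂₂ 1 0 1 0 (-1) 1
      - h.r₃ 1 0 1 (-1) 0 0)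
    + 𝐪 * (h.r₁₁ (-1) 0 (-1) 2 1 1 + h.r₁₁ 0 0 1 2 1 0 + h.r₁₁ 0 1 1 0 0 1 + h.r₁₁ 0 1 1 0 1 1
      + h.r₂₁ 1 (-1) 2 0 1 1 + h.r₂₁ 1 0 2 (-1) 0 2 + h.r₂₂ 1 0 0 (-1) 0 2 + h.r₂₂ 1 0 2 0 (-1) 2
      + h.r₄ 0 (-1) (-1) 2 1 1 + h.r₄ 0 (-1) 0 2 1 1 - h.r₁₁ (-1) 0 1 1 1 1 - h.r₁₁ 0 0 2 1 0 1
      - h.r₁₂ 0 (-1) 1 1 1 1 - h.r₁₂ 1 (-1) 2 0 1 1 - h.r₂₁ 1 0 0 (-1) 0 2 - h.r₂₁ 1 0 2 (-1) 0 1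
      - h.r₂₁ 1 1 1 0 1 1 - h.r₂₂ 1 0 0 0 (-1) 2 - h.r₂₂ 1 0 2 0 (-1) 1)
    + 𝐪 * 𝐳 * (h.r₁₁ 1 1 0 1 0 1 + h.r₂₁ 1 0 1 0 1 1 + h.r₂₁ 2 1 0 (-1) 0 1
      + h.r₂₂ 2 1 0 0 (-1) 1 - h.r₁₁ 0 0 0 1 1 1 - h.r₁₂ 1 (-1) 0 1 1 1 - h.r₁₂ 2 0 1 0 0 0
      - h.r₂₁ 2 0 0 0 1 1 - h.r₂₁ 2 0 1 (-1) 0 0 - h.r₂₁ 2 0 1 (-1) 0 1 - h.r₂₂ 2 0 1 0 (-1) 0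
      - h.r₂₂ 2 0 1 0 (-1) 1 - h.r₃ 2 0 1 0 0 (-1))
    + 𝐪 ^ 2 * (h.r₁₁ 0 0 0 2 2 1 + h.r₁₂ 0 (-1) 1 2 2 1 - h.r₁₁ 0 1 1 2 1 1)
    + 𝐪 ^ 2 * 𝐳 * (h.r₁₁ 0 0 1 2 1 1 + h.r₁₁ 2 2 1 0 (-1) 0 + h.r₂₁ 2 1 1 (-1) 0 1
      + h.r₂₁ 2 1 1 (-1) 1 1 + h.r₂₂ 2 1 1 0 (-1) 1 - h.r₁₂ 2 0 2 0 0 0 - h.r₂₁ 3 1 1 (-1) 0 0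
      - h.r₂₂ 3 1 1 (-1) (-1) 0 - h.r₂₂ 3 1 1 (-1) (-1) 1 - h.r₃ 3 1 1 (-1) 0 (-1))
    + 𝐪 ^ 3 * 𝐳 * (h.r₁₁ 2 2 2 0 (-1) 0 - h.r₂₁ 3 1 2 (-1) 0 0)
    + (1 - 𝐪 * 𝐳) * (h.r₁₁ 1 0 1 1 0 0 + h.r₁₂ 2 (-1) 1 0 1 0 - h.r₁₁ 2 1 1 0 0 0
      - h.r₂₁ 2 (-1) 1 0 1 0 - h.r₂₂ 2 0 0 0 0 1)
    + (𝐳 + 𝐪) * (h.r₂₁ 1 0 0 (-1) 1 1)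
    + 𝐪 * (1 - 𝐪 * 𝐳) * (h.r₂₁ 2 0 1 0 1 1 - h.r₁₁ 1 1 1 1 0 1)
    - 𝐪 * 𝐳 * (1 - 𝐪 * 𝐳) * val φ 2 0 0 0 1 1 * map_q_mul_map_qpow_neg_one B

theorem map_coupledRel_5_1_4 (h : KillsRelations φ) : φ (coupledRel ![5, 1, 4]) = 0 := by
  rw [coupledRel_pos]
  simp [overLine, underLine, -map_smul]
  -- The certificate is for `q` times the relation: this clears `q⁻¹` from the multipliers of the
  -- generators, and nothing is lost because `q` is a unit.
  refine (isUnit_q.map (algebraMap Coeff B)).mul_right_eq_zero.1 ?_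
  linear_combination (norm := (simp; ring1))
    (h.r₁₁ 1 0 0 0 0 1 - h.r₁₁ 1 0 1 0 0 (-1) - h.r₃ 2 (-1) 1 0 0 (-1) - h.r₃ 2 (-1) 1 0 0 0)
    + 𝐪 * (h.r₁₁ (-1) 0 1 0 0 0 + h.r₁₂ 0 (-1) 1 0 0 0 + h.r₂₁ 2 0 0 (-1) 1 0
      + h.r₂₂ 2 0 0 (-1) 0 1 + h.r₂₂ 2 1 0 (-1) (-1) 1 + h.r₃ 2 1 0 (-1) (-1) 0
      - h.r₁₁ (-1) 0 0 1 1 1 - h.r₁₁ 0 0 (-1) 1 1 1 - h.r₁₁ 1 0 1 0 0 2 - h.r₁₂ 0 (-1) 0 1 1 1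
      - h.r₁₂ 1 (-1) 1 1 1 1 - h.r₁₂ 2 (-1) 2 0 0 0 - h.r₂₁ 0 0 1 0 1 0 - h.r₂₂ 0 0 1 0 0 1
      - h.r₂₂ 2 1 0 (-1) (-1) 0 - h.r₃ 2 1 0 (-1) 0 (-1) - h.r₄ 1 (-1) (-1) 1 1 1
      - h.r₄ 1 (-1) 0 1 1 1)
    + 𝐪 * 𝐳 * (h.r₁₁ 1 1 0 0 0 0 + h.r₁₂ 1 0 1 0 0 0 + h.r₂₁ 1 0 1 (-1) 0 0
      + h.r₂₂ 1 0 1 0 (-1) 0 - h.r₁₁ 0 0 0 0 0 1 - h.r₁₂ 1 (-1) 0 0 0 1 - h.r₄ 1 0 (-1) 0 0 1)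
    + 𝐪 ^ 2 * (h.r₁₁ 0 (-1) 0 2 2 1 + h.r₁₁ 0 1 1 0 1 1 + h.r₁₂ 1 (-1) 0 1 2 1
      + h.r₁₂ 1 (-1) 2 1 1 2 + h.r₂₂ 2 1 1 (-1) (-1) 1 - h.r₁₁ (-1) 0 1 2 1 0
      - h.r₁₁ (-1) 1 1 0 0 1 - h.r₁₁ 0 1 1 1 1 1 - h.r₁₂ 1 (-1) 0 1 1 2 - h.r₂₂ 2 1 1 (-1) (-1) 2)
    + 𝐪 ^ 2 * 𝐳 * (h.r₁₁ 1 1 1 1 0 (-1) + h.r₁₁ 2 1 1 0 (-1) (-1) + h.r₁₂ 2 (-1) 0 0 0 1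
      + h.r₁₂ 2 0 1 0 0 1 + h.r₂₁ 1 0 1 0 1 1 + h.r₂₁ 2 1 1 (-1) 0 (-1) + h.r₂₁ 3 0 0 (-1) 0 1
      + h.r₂₂ 2 1 0 0 (-1) 1 + h.r₂₂ 2 1 1 (-1) (-1) 0 + h.r₄ 2 0 (-1) 0 0 1 - h.r₁₁ 0 1 1 1 0 1
      - h.r₁₁ 1 1 1 0 0 1 - h.r₁₁ 2 1 0 0 (-1) 1 - h.r₁₂ 2 (-1) 1 0 0 1 - h.r₁₂ 2 0 1 0 0 0
      - h.r₂₁ 1 1 1 (-1) 0 1 - h.r₂₁ 2 0 (-1) 0 1 1 - h.r₂₁ 3 0 1 (-1) 0 (-1) - h.r₂₂ 1 0 0 0 0 2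
      - h.r₂₂ 1 1 1 0 (-1) 1 - h.r₄ 2 0 (-1) 1 0 1)
    + 𝐪 ^ 3 * (h.r₁₁ 0 (-1) 0 2 2 2 - h.r₁₁ (-1) 0 0 2 2 1 - h.r₁₂ (-1) (-1) 1 2 2 1)
    + 𝐪 ^ 3 * 𝐳 * (h.r₁₁ 2 1 1 0 (-1) 2 + h.r₁₂ 2 (-1) 2 0 0 2 + h.r₂₁ 2 1 1 (-1) 1 1
      + h.r₂₁ 3 0 0 (-1) 0 2 + h.r₂₁ 3 1 1 (-1) 0 1 + h.r₂₂ 3 0 0 0 (-1) 2 + h.r₂₂ 3 1 1 0 (-1) 1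
      + h.r₃ 3 1 1 0 0 (-1) + h.r₃ 3 1 1 0 0 0 - h.r₁₁ 1 0 0 1 2 1 - h.r₁₂ 2 (-1) 1 0 0 2
      - h.r₂₁ 2 1 1 0 1 1 - h.r₂₁ 3 0 0 (-1) 1 1 - h.r₂₁ 3 0 1 (-1) 0 2 - h.r₂₂ 2 1 1 0 (-1) 2
      - h.r₂₂ 3 0 0 (-1) 0 2 - h.r₄ 1 0 (-1) 2 1 1)
    + 𝐪 ^ 3 * 𝐳 ^ 2 * (-h.r₂₂ 3 1 0 (-1) (-1) 1)
    + 𝐪 ^ 4 * 𝐳 * (-h.r₁₁ 1 0 0 2 1 2 - h.r₁₁ 1 1 1 2 1 1 - h.r₂₂ 3 1 0 0 0 2)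
    + 𝐪 ^ 5 * 𝐳 ^ 2 * (h.r₃ 4 1 1 (-1) (-1) (-1) + h.r₃ 4 1 1 (-1) (-1) 0 - h.r₂₁ 3 0 0 0 2 1)
    + 𝐪 ^ 6 * 𝐳 ^ 2 * (h.r₂₁ 4 2 1 (-1) 0 0 + h.r₂₂ 4 2 1 (-1) (-1) 1)
    + (1 + 𝐪 * 𝐳) * (h.r₃ 1 0 1 0 0 (-1) + h.r₃ 1 0 1 0 0 0 - h.r₄ 1 0 0 0 0 1)
    + (1 - 𝐪 ^ 2 * 𝐳) * (h.r₄ 2 (-1) 0 0 0 1)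
    + 𝐪 * (1 - 𝐳) * (h.r₁₁ 1 1 1 0 0 0 + h.r₂₁ 1 (-1) 1 0 1 0 + h.r₂₂ 1 0 0 0 0 1
      - h.r₁₁ 0 0 1 1 0 0 - h.r₁₂ 1 (-1) 1 0 1 0)
    + 𝐪 * (1 + 𝐪 * 𝐳) * (h.r₁₁ 0 0 1 0 1 1 + h.r₁₂ 1 (-1) 1 0 1 1 + h.r₁₂ 1 0 2 0 0 0)
    + 𝐪 * (1 + 𝐪 * 𝐳 ^ 2) * (h.r₂₁ 1 0 0 0 1 1 - h.r₂₁ 2 0 0 (-1) 0 1 - h.r₂₂ 2 0 0 0 (-1) 1)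
    + 𝐪 ^ 2 * (1 + 𝐪 * 𝐳 ^ 2) * (h.r₁₁ 0 0 0 2 1 1)
    + 𝐪 ^ 2 * 𝐳 * (1 + 𝐪 * 𝐳) * (h.r₂₁ 2 0 1 (-1) 1 1)
    + 𝐪 ^ 3 * 𝐳 * (1 - 𝐪 * 𝐳) * (h.r₁₁ 2 0 1 0 0 0 + h.r₁₂ 3 (-1) 1 0 0 0
      + h.r₂₂ 3 1 1 0 (-1) 0 - h.r₁₁ 3 1 1 0 (-1) 0 - h.r₂₁ 3 0 1 0 1 0 - h.r₂₂ 3 0 1 0 0 1)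
    + 𝐪 ^ 4 * 𝐳 * (1 - 𝐪 * 𝐳) * (-h.r₁₁ 2 1 1 0 0 1)
    + 𝐪 ^ 5 * 𝐳 * (1 - 𝐪 * 𝐳) * (-h.r₁₂ 2 (-1) 1 2 2 1)
    + 𝐪 ^ 6 * 𝐳 ^ 2 * (1 - 𝐪 * 𝐳) * (h.r₂₁ 4 0 1 (-1) 0 0)
    + 𝐪 ^ 7 * 𝐳 ^ 2 * (1 - 𝐪 * 𝐳) * (h.r₂₁ 3 1 1 0 1 1 - h.r₂₁ 4 1 1 (-1) 0 1
      - h.r₂₂ 4 1 1 0 (-1) 1)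
    + 𝐪 ^ 8 * 𝐳 ^ 2 * (1 - 𝐪 * 𝐳) * (h.r₁₁ 2 1 1 2 1 1)
    + (1 - 𝐪 * 𝐳 - 𝐪 ^ 3 * 𝐳 + 𝐪 ^ 4 * 𝐳 ^ 2) * (h.r₁₁ 2 (-1) 1 1 1 0
      + h.r₁₁ 2 0 (-1) 1 0 1 + h.r₁₂ 2 (-1) 0 1 0 1 + h.r₁₂ 3 (-2) 1 1 1 0 - h.r₁₁ 2 (-1) 0 1 0 1
      - h.r₁₁ 2 0 0 1 1 0 - h.r₁₂ 2 (-1) 1 1 1 0 - h.r₁₂ 3 (-2) 0 1 0 1)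
    + 𝐪 * (1 - 𝐪 * 𝐳 - 𝐪 ^ 3 * 𝐳 + 𝐪 ^ 4 * 𝐳 ^ 2) * (h.r₁₁ 2 (-1) 1 1 1 1
      + h.r₁₂ 2 (-2) 1 1 1 1 + h.r₁₂ 3 (-2) 1 1 1 1 + h.r₄ 2 (-2) (-1) 1 1 1
      + h.r₄ 2 (-2) 0 1 1 1 - h.r₁₁ 2 0 0 1 1 1 - h.r₁₂ 2 (-2) (-1) 1 1 1 - h.r₁₂ 2 (-1) 1 1 1 1
      - h.r₄ 2 (-1) (-2) 1 1 1 - h.r₄ 2 (-1) (-1) 1 1 1)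
    + 𝐪 ^ 2 * (1 - 𝐪 * 𝐳 - 𝐪 ^ 3 * 𝐳 + 𝐪 ^ 4 * 𝐳 ^ 2) * (h.r₁₂ 2 (-2) 0 1 1 2
      - h.r₁₂ 2 (-2) 2 1 1 2)
    + 𝐪 ^ 3 * 𝐳 * (1 - 𝐪 * 𝐳 - 𝐪 ^ 3 * 𝐳 + 𝐪 ^ 4 * 𝐳 ^ 2) * (h.r₁₁ 3 0 0 0 0 1
      + h.r₂₁ 4 (-1) 1 0 1 0 + h.r₂₂ 4 0 0 0 0 1 + h.r₂₂ 4 1 0 0 (-1) 1 - h.r₁₁ 3 0 1 1 0 0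
      - h.r₂₂ 4 0 1 0 (-1) 0 - h.r₃ 4 0 1 0 0 (-1) - h.r₃ 4 0 1 0 0 0)
    + 𝐪 ^ 4 * 𝐳 * (1 - 𝐪 * 𝐳 - 𝐪 ^ 3 * 𝐳 + 𝐪 ^ 4 * 𝐳 ^ 2) * (h.r₁₁ 3 1 1 0 1 1
      + h.r₂₂ 4 0 0 0 0 2 - h.r₁₁ 3 0 1 0 1 1)
    + 𝐪 ^ 7 * 𝐳 ^ 2 * (1 - 𝐪 * 𝐳 - 𝐪 ^ 3 * 𝐳 + 𝐪 ^ 4 * 𝐳 ^ 2) * (h.r₂₁ 5 0 0 (-1) 0 1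
      - h.r₂₁ 4 0 0 0 1 1)
    + 𝐪 ^ 8 * 𝐳 ^ 2 * (1 - 𝐪 * 𝐳 - 𝐪 ^ 3 * 𝐳 + 𝐪 ^ 4 * 𝐳 ^ 2) * (h.r₂₁ 5 1 1 (-1) 1 1
      - h.r₂₁ 5 0 1 (-1) 1 1)
    + 𝐪 ^ 3 * 𝐳 * (1 - 𝐪 * 𝐳 - 𝐪 ^ 3 * 𝐳 - 𝐪 ^ 4 * 𝐳 + 𝐪 ^ 4 * 𝐳 ^ 2 + 𝐪 ^ 5 * 𝐳 ^ 2 + 𝐪 ^ 7 * 𝐳 ^ 2 - 𝐪 ^ 8 * 𝐳 ^ 3) * (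
      -h.r₂₂ 5 0 0 0 (-1) 1)
    + 𝐪 ^ 4 * 𝐳 * (1 - 𝐪 * 𝐳 - 𝐪 ^ 3 * 𝐳 - 𝐪 ^ 4 * 𝐳 + 𝐪 ^ 4 * 𝐳 ^ 2 + 𝐪 ^ 5 * 𝐳 ^ 2 + 𝐪 ^ 7 * 𝐳 ^ 2 - 𝐪 ^ 8 * 𝐳 ^ 3) * (
      h.r₁₁ 3 0 0 2 1 1)
    + 𝐪 * 𝐳 * val φ 1 0 0 0 1 1 * map_q_mul_map_qpow_neg_one B

theorem map_coupledRel_4_4_2 (h : KillsRelations φ) : φ (coupledRel ![4, 4, 2]) = 0 := by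
  rw [coupledRel_pos]
  simp [overLine, underLine, -map_smul]
  linear_combination (norm := (simp; ring1))
    (h.r₁₁ (-1) 0 0 0 0 1 + h.r₁₁ 0 0 0 0 0 1 + h.r₁₂ 0 (-1) 0 0 0 1 + h.r₁₂ 1 (-1) 0 0 0 1
      + h.r₁₂ 1 0 1 0 0 1 + h.r₂₂ 1 1 0 0 (-1) 1 + h.r₄ 0 0 (-1) 0 0 1 + h.r₄ 1 0 (-1) 0 0 1
      - h.r₁₁ 0 1 0 0 0 0 - h.r₁₁ 1 1 0 0 (-1) 1 - h.r₁₂ 0 0 1 0 0 0 - h.r₁₂ 1 0 1 0 0 0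
      - h.r₂₁ 1 0 (-1) 0 1 1 - h.r₃ 1 0 0 0 0 0 - h.r₄ 1 0 (-1) 1 0 1)
    + 𝐳 * (h.r₁₁ 0 0 0 1 0 1 + h.r₂₁ 1 0 0 (-1) 0 1 + h.r₂₂ 1 0 0 0 (-1) 1
      - h.r₂₁ 1 (-1) 0 0 1 1)
    + 𝐪 * (h.r₁₁ 0 0 0 0 0 2 + h.r₁₁ 0 0 1 1 1 1 + h.r₁₁ 0 1 1 0 0 1 + h.r₁₂ 1 (-1) 0 0 0 2
      + h.r₁₂ 1 (-1) 1 1 1 1 + h.r₂₁ 2 0 0 (-1) 0 2 + h.r₂₂ 1 0 (-1) 0 0 2 + h.r₂₂ 1 1 0 0 (-1) 2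
      - h.r₁₁ (-1) 0 1 0 1 1 - h.r₁₁ 0 0 1 0 0 2 - h.r₁₁ 1 1 0 0 (-1) 2 - h.r₁₁ 1 1 1 0 1 1
      - h.r₁₂ 0 (-1) 1 0 1 1 - h.r₁₂ 1 (-1) 1 0 0 2 - h.r₄ 0 0 (-1) 2 1 1)
    + 𝐪 * 𝐳 * (h.r₂₁ 2 0 0 (-1) 0 1 + h.r₂₂ 2 1 0 (-1) (-1) 1 - h.r₂₁ 1 0 1 (-1) 1 1)
    + 𝐪 ^ 2 * (h.r₁₁ 0 0 1 2 1 2)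
    + 𝐪 ^ 2 * 𝐳 * (h.r₁₁ 1 1 1 0 0 1 - h.r₂₁ 2 0 1 (-1) 0 2 - h.r₂₂ 2 0 1 0 (-1) 2)
    + 𝐪 ^ 3 * 𝐳 * (h.r₂₁ 3 2 1 (-1) 0 0 + h.r₂₂ 3 2 1 (-1) (-1) 1 - h.r₂₁ 3 1 1 (-1) 1 1
      - h.r₂₂ 3 1 1 (-1) (-1) 2)
    + (1 + 𝐪) * (h.r₁₁ 1 1 0 0 0 1 - h.r₁₂ 1 (-1) 0 0 1 1)
    + (1 - 𝐪 * 𝐳) * (h.r₁₁ 1 0 1 0 0 0 + h.r₁₂ 2 (-1) 1 0 0 0 + h.r₂₁ 2 (-1) 1 0 1 0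
      + h.r₂₁ 2 0 1 (-1) 0 1 + h.r₂₂ 2 0 0 0 0 1 + h.r₂₂ 2 0 1 0 (-1) 1 + h.r₃ 2 0 1 (-1) 0 0
      - h.r₁₁ 1 0 1 1 0 0 - h.r₁₂ 2 (-1) 1 0 1 0 - h.r₂₁ 2 0 1 (-1) 0 0 - h.r₂₁ 2 0 1 0 1 0
      - h.r₂₂ 2 0 0 0 (-1) 1 - h.r₂₂ 2 0 1 0 (-1) 0 - h.r₂₂ 2 0 1 0 0 1 - h.r₃ 2 0 1 0 0 (-1)
      - h.r₄ 1 0 0 1 0 1)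
    + 𝐪 * (1 - 𝐪 * 𝐳) * (h.r₁₁ 1 0 2 1 0 1 + h.r₁₁ 2 1 1 0 1 1 + h.r₁₂ 2 (-1) 2 0 1 1
      + h.r₂₁ 2 0 2 (-1) 0 1 + h.r₂₂ 2 0 2 0 (-1) 1 - h.r₁₁ 1 0 1 2 1 0 - h.r₂₁ 2 (-1) 2 0 1 1
      - h.r₂₁ 2 0 2 (-1) 0 2 - h.r₂₂ 2 0 0 (-1) 0 2 - h.r₂₂ 2 0 2 0 (-1) 2 - h.r₄ 1 (-1) 0 2 1 1)
    + 𝐪 ^ 2 * (1 - 𝐪 * 𝐳) * (-h.r₁₁ 1 0 0 2 2 1 - h.r₁₂ 1 (-1) 1 2 2 1)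
    + 𝐪 ^ 2 * 𝐳 * (1 - 𝐪 * 𝐳) * (h.r₂₁ 3 0 1 (-1) 0 0 + h.r₂₂ 3 0 1 0 (-1) 0
      + h.r₃ 3 0 1 0 0 (-1))
    + 𝐪 ^ 3 * 𝐳 * (1 - 𝐪 * 𝐳) * (h.r₁₂ 3 0 2 0 0 0 + h.r₂₁ 3 0 1 0 1 1
      + h.r₂₂ 4 1 1 (-1) (-1) 0 + h.r₃ 4 1 1 (-1) 0 (-1) - h.r₁₁ 2 1 1 1 0 1
      - h.r₂₁ 3 1 1 (-1) 0 1 - h.r₂₂ 3 1 1 0 (-1) 1)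
    + 𝐪 ^ 4 * 𝐳 * (1 - 𝐪 * 𝐳) * (h.r₂₁ 4 1 1 (-1) 1 1 + h.r₂₁ 4 1 2 (-1) 0 0
      - h.r₁₁ 3 2 2 0 (-1) 0)
    + (1 + 𝐳 + 𝐪) * (-h.r₁₁ 0 0 0 0 1 1)
    + 𝐪 * (1 + 𝐳 + 𝐳 ^ 2) * (-h.r₂₁ 2 0 0 (-1) 1 1)
    + (1 - 𝐪 * 𝐳 - 𝐪 ^ 2 * 𝐳 + 𝐪 ^ 3 * 𝐳 ^ 2) * (h.r₁₁ 3 1 1 0 0 0 + h.r₂₁ 3 (-1) 1 0 1 0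
      + h.r₂₂ 3 0 0 0 0 1 - h.r₁₁ 2 0 1 1 0 0 - h.r₁₂ 3 (-1) 1 0 1 0)

theorem map_coupledRel_4_3_3 (h : KillsRelations φ) : φ (coupledRel ![4, 3, 3]) = 0 := by
  rw [coupledRel_pos]
  simp [overLine, underLine, -map_smul]
  linear_combination (norm := (simp; ring1))
    (h.r₁₁ 0 0 0 0 0 0 + h.r₁₂ 1 (-1) 0 0 0 0 + h.r₃ 1 0 1 0 0 0 + h.r₄ 1 0 (-1) 0 0 0
      - h.r₁₁ 0 0 0 0 0 1 - h.r₁₂ 1 (-1) 0 0 0 1 - h.r₄ 1 0 (-1) 0 0 1 - h.r₄ 1 0 0 0 0 1)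
    + 𝐪 * (h.r₁₁ 0 0 1 0 1 1 + h.r₁₂ 1 (-1) 1 0 1 1 + h.r₁₂ 1 0 2 0 0 1 - h.r₁₁ 0 0 1 0 0 1
      - h.r₁₂ 1 (-1) 1 0 0 1 - h.r₂₂ 1 0 0 0 0 2)
    + 𝐪 * 𝐳 * (h.r₂₁ 1 0 0 0 1 1 + h.r₂₁ 2 0 0 (-1) 0 0 + h.r₂₂ 2 0 0 0 (-1) 0
      + h.r₃ 2 0 0 0 0 (-1) - h.r₂₁ 1 0 0 0 1 0 - h.r₂₁ 2 0 0 (-1) 0 1 - h.r₂₂ 1 0 0 0 0 1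
      - h.r₂₂ 2 0 0 0 (-1) 1)
    + 𝐪 ^ 2 * 𝐳 * (h.r₁₁ 0 0 0 2 1 1 + h.r₂₁ 1 0 1 0 1 1 + h.r₂₁ 2 0 1 (-1) 1 1
      + h.r₂₂ 3 1 0 (-1) (-1) 0 + h.r₃ 3 1 0 (-1) 0 (-1) - h.r₁₁ 0 0 0 2 1 0
      - h.r₂₁ 2 0 1 (-1) 0 1 - h.r₂₂ 2 0 1 0 (-1) 1 - h.r₂₂ 3 1 0 (-1) (-1) 1)
    + 𝐪 ^ 3 * 𝐳 * (h.r₁₁ 0 0 1 2 1 1 + h.r₃ 3 2 1 (-1) (-1) (-1) - h.r₁₁ 0 0 (-1) 2 2 1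
      - h.r₁₂ 0 (-1) 0 2 2 1 - h.r₂₂ 3 1 1 (-1) (-1) 1)
    + 𝐪 ^ 2 * 𝐳 * (1 - 𝐪 * 𝐳) * (h.r₂₁ 3 0 0 (-1) 0 1 + h.r₂₂ 3 0 0 0 (-1) 1
      - h.r₂₁ 2 0 0 0 1 1 - h.r₂₁ 3 0 0 (-1) 1 0 - h.r₂₂ 3 0 0 (-1) 0 1)
    + 𝐪 ^ 3 * 𝐳 * (1 - 𝐪 * 𝐳) * (h.r₁₁ 2 1 0 1 1 1 - h.r₁₁ 1 0 0 2 1 1 - h.r₁₂ 2 (-1) 0 1 2 1)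

/-- The profiles whose coupled relation is an identity in the polynomial ring, so that it holds
without any use of the relations. -/
theorem map_coupledRel_of_mem (φ : Poly →ₐ[Coeff] B) {c : Profile}
    (hc : c ∈ ([![10, 0, 0], ![9, 0, 1], ![8, 0, 2], ![7, 0, 3], ![6, 0, 4], ![7, 3, 0],
      ![6, 3, 1], ![5, 3, 2], ![5, 2, 3]] : List Profile)) :
    φ (coupledRel c) = 0 := by
  simp only [List.mem_cons, List.not_mem_nil, or_false] at hc
  rcases hc with rfl | rfl | rfl | rfl | rfl | rfl | rfl | rfl | rfl
  case _ => simp [coupledRel_mid_right_zero, overLine, -map_smul]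
  all_goals
    simp [coupledRel_pos, coupledRel_right_zero, coupledRel_mid_zero, overLine, underLine,
      -map_smul]
    ring1

/-! ### Reduction to the canonical profiles -/

theorem map_coupledRel_of_canonical (h : KillsRelations φ) {a b c : ℕ} (hs : a + b + c = 10)
    (hb : b ≤ a) (hc : c < a) : φ (coupledRel ![a, b, c]) = 0 := by
  obtain rfl : c = 10 - a - b := by omega
  have ha : a ≤ 10 := by omega
  have ha' : 4 ≤ a := by omega
  -- The largest part of a sum of three equal to 10 is at least 4. Of the pairs `(a, b)`, `omega`
  -- discards those violating the sum or `c < a`, leaving 22.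
  interval_cases a <;> interval_cases b <;> try omega
  · exact map_coupledRel_4_3_3 h
  · exact map_coupledRel_4_4_2 h
  · exact map_coupledRel_5_1_4 h
  · exact map_coupledRel_of_mem φ (by decide)
  · exact map_coupledRel_of_mem φ (by decide)
  · exact map_coupledRel_5_4_1 h
  · exact map_coupledRel_5_5_0 h
  · exact map_coupledRel_of_mem φ (by decide)
  · exact map_coupledRel_6_1_3 h
  · exact map_coupledRel_6_2_2 h
  · exact map_coupledRel_of_mem φ (by decide)
  · exact map_coupledRel_6_4_0 φ
  · exact map_coupledRel_of_mem φ (by decide)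
  · exact map_coupledRel_7_1_2 h
  · exact map_coupledRel_7_2_1 h
  · exact map_coupledRel_of_mem φ (by decide)
  · exact map_coupledRel_of_mem φ (by decide)
  · exact map_coupledRel_8_1_1 h
  · exact map_coupledRel_8_2_0 h
  · exact map_coupledRel_of_mem φ (by decide)
  · exact map_coupledRel_9_1_0 h
  · exact map_coupledRel_of_mem φ (by decide)

theorem map_coupledRel (h : KillsRelations φ) (c : Profile) (hc : c 0 + c 1 + c 2 = 10) :
    φ (coupledRel c) = 0 := by
  obtain ⟨a, b, d, rfl⟩ : ∃ a b d, c = ![a, b, d] :=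
    ⟨c 0, c 1, c 2, by funext i; fin_cases i <;> rfl⟩
  simp only [Matrix.cons_val] at hc
  have h₁ : coupledRel ![b, d, a] = coupledRel ![a, b, d] := by
    rw [← coupledRel_rotate ![a, b, d] hc, rotate_cons]
  have h₂ : coupledRel ![d, a, b] = coupledRel ![b, d, a] := by
    rw [← coupledRel_rotate ![b, d, a] (show b + d + a = 10 by omega), rotate_cons]
  -- One of the three rotations is canonical, since the parts cannot all be equal.
  obtain h' | h' | h' : (b ≤ a ∧ d < a) ∨ (d ≤ b ∧ a < b) ∨ (a ≤ d ∧ b < d) := by omega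
  · exact map_coupledRel_of_canonical h hc h'.1 h'.2
  · rw [← h₁]
    exact map_coupledRel_of_canonical h (by omega) h'.1 h'.2
  · rw [← h₁, ← h₂]
    exact map_coupledRel_of_canonical h (by omega) h'.1 h'.2

end CylMod13

end

theorem theorem5p1 (c : CylMod13.Profile) (hc : c 0 + c 1 + c 2 = 10) :
    CylMod13.coupledRel c ∈ CylMod13.relIdeal 6 :=
  Ideal.Quotient.eq_zero_iff_mem.1
    (CylMod13.map_coupledRel CylMod13.killsRelations_mk c hc)
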